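/- Let $(\mathbb A,+)$ be a finite Abelian group with $|\mathbb A|\ge 2$. For $x\in\mathbb A^{\mathbb Z}$ put $\tau x(i)=x(i)+x(i+1)$, and for $\varepsilon>0$ let $\tau_\varepsilon$ be the Markov kernel on $\mathbb A^{\mathbb Z}$ for which $\tau_\varepsilon(x,\cdot)$ is the law of $\tau x+\xi$, where the $\xi(i)$, $i\in\mathbb Z$, are independent, equal to $0$ with probability $1-\varepsilon$ and to each $a\ne 0$ with probability $\varepsilon/(|\mathbb A|-1)$. Let $\mu$ be the uniform product measure on $\mathbb A^{\mathbb Z}$. Conventions. A dynamical system $(\Omega,\mathbb P,T)$ is a standard Borel probability space with an invertible bimeasurable transformation $T$ preserving $\mathbb P$. A factor sigma-algebra is a sub-sigma-algebra of the Borel sigma-algebra that contains the negligible Borel sets and is invariant under $T$ and $T^{-1}$. A factor filtration $(\mathscr F,T)$ is a non-decreasing family $\mathscr F=(\mathscr F_n)_{n\le 0}$ of factor sigma-algebras. A process $(X_n)_{n\le0}$ generates $\mathscr F$ if, for each $n\le 0$, $\mathscr F_n$ is generated by the $X_m$, $m\le n$, and the negligible sets. A $T$-process is a process of the form $(Z\circ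 T^i)_{i\in\mathbb Z}$ with $Z$ a random variable in a standard Borel space. * $(\mathscr F,T)$ and $(\mathscr F',T')$, possibly on different dynamical systems, are dynamically isomorphic if they are generated by processes $(X_n)_{n\le0}$ and $(X'_n)_{n\le 0}$ with the same law such that each $X_n$ is a $T$-process and each $X'_n$ is a $T'$-process. * $\mathscr F$ is immersed in $\mathscr G$ if $\mathscr F_n\subset\mathscr G_n$ for all $n\le 0$ and, for all $n\le -1$, $\mathscr F_{n+1}$ and $\mathscr G_n$ are independent conditionally to $\mathscr F_n$. * $(\mathscr G,S)$ is dynamically of product type if there are independent factor sigma-algebras $(\mathscr H_n)_{n\le0}$ with $\mathscr G_n=\bigvee_{m\le n}\mathscr H_m$ for all $n\le 0$. * $(\mathscr F,T)$ is dynamically standard if it is dynamically isomorphic to a factor filtration $(\mathscr F',S)$ immersed in some factor filtration $(\mathscr G,S)$ that is dynamically of product type. Theorem. There exists $\varepsilon_0$ with $0<\varepsilon_0<\frac{|\mathbb A|-1}{|\mathbb A|}$ such that, for each $\varepsilon$ with $\varepsilon_0<\varepsilon\le\frac{|\mathbb A|-1}{|\mathbb A|}$, the following holds. There is exactly one measure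 $\mathbb P$ on $(\mathbb A^{\mathbb Z})^{\mathbb Z}$ under which the coordinate process $(X_n)_{n\in\mathbb Z}$ is a stationary Markov chain with transition kernel $\tau_\varepsilon$ and $X_n\sim\mu$ for all $n$. For this $\mathbb P$, let $\mathscr F^{\tau_\varepsilon}$ be the filtration generated by $(X_n)_{n\le 0}$ and let $\sigma$ be the left shift, $(\sigma x)_n(i)=x_n(i+1)$. Then $(\mathscr F^{\tau_\varepsilon},\sigma)$ is a factor filtration on $((\mathbb A^{\mathbb Z})^{\mathbb Z},\mathbb P,\sigma)$, and it is dynamically standard. -/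

import Mathlib

open MeasureTheory ProbabilityTheory

namespace FactorFiltrations

universe u v

/-- The set of times `n ≤ 0`. -/
abbrev NegTime : Type := {n : ℤ // n ≤ 0}

section Abstract

variable {Ω : Type u} {mΩ : MeasurableSpace Ω} {Ω' : Type v} {mΩ' : MeasurableSpace Ω'}

/-- The completion of a family `m` of measurable events inside the ambient (Borel) sigma-algebra:
the measurable sets that differ from a set of `m` by a `P`-null set. For `m` contained in the ambient
sigma-algebra this is the sigma-algebra generated by `m` and the negligible measurable sets. -/
@[reducible]
def completion (P : Measure Ω) (m : MeasurableSpace Ω) : MeasurableSpace Ω :=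
  @eventuallyMeasurableSpace Ω m (ae P) _ ⊓ mΩ

/-- A factor sigma-algebra of `(Ω, P, T)`: a complete sub-sigma-algebra of the Borel sigma-algebra
that is invariant under `T` and its inverse. (On a standard Borel probability space every
such sigma-algebra is automatically essentially separable.) -/
structure IsFactorAlgebra (P : Measure Ω) (T : Ω ≃ᵐ Ω) (m : MeasurableSpace Ω) : Prop where
  le : m ≤ mΩ
  complete : ∀ s : Set Ω, MeasurableSet[mΩ] s → P s = 0 → MeasurableSet[m] s
  preimage : ∀ s : Set Ω, MeasurableSet[m] s → MeasurableSet[m] (T ⁻¹' s)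
  image : ∀ s : Set Ω, MeasurableSet[m] s → MeasurableSet[m] (T '' s)

/-- `(F, T)` is a factor filtration on the dynamical system `(Ω, P, T)`. -/
structure IsFactorFiltration (P : Measure Ω) (T : Ω ≃ᵐ Ω) (F : NegTime → MeasurableSpace Ω) :
    Prop where
  isProbabilityMeasure : IsProbabilityMeasure P
  measurePreserving : MeasurePreserving T P P
  mono : Monotone F
  factor : ∀ n, IsFactorAlgebra P T (F n)

/-- The filtration generated by a process in negative time:
at time `n`, the sigma-algebra generated by `X m`, `m ≤ n`, and the negligible sets. -/
@[reducible]
def generated {E : NegTime → Type*} [∀ n, MeasurableSpace (E n)] (P : Measure Ω)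
    (X : ∀ n, Ω → E n) (n : NegTime) : MeasurableSpace Ω :=
  completion P (⨆ (m : NegTime) (_ : m ≤ n), MeasurableSpace.comap (X m) inferInstance)

/-- `X = (X(i))_{i ∈ ℤ}` is a `T`-process: `X(i) = X(0) ∘ T ^ i` for all `i`. -/
structure IsTProcess {E : Type*} [MeasurableSpace E] (T : Ω ≃ᵐ Ω) (X : Ω → ℤ → E) : Prop where
  measurable : Measurable X
  eq_comp : ∀ (i : ℤ) (ω : Ω), X ω i = X (((T.toEquiv : Equiv.Perm Ω) ^ i) ω) 0

/-- Dynamical isomorphism of the factor filtrations `(F, T)` and `(F', T')`: they are generated by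
processes with the same law, the coordinates of which are `T`-processes, resp. `T'`-processes,
with values in standard Borel (i.e. Polish) spaces. -/
def DynIsomorphic (P : Measure Ω) (T : Ω ≃ᵐ Ω) (F : NegTime → MeasurableSpace Ω)
    (P' : Measure Ω') (T' : Ω' ≃ᵐ Ω') (F' : NegTime → MeasurableSpace Ω') : Prop :=
  ∃ (E : NegTime → Type (max u v)) (_ : ∀ n, MeasurableSpace (E n))
    (_ : ∀ n, StandardBorelSpace (E n))
    (X : ∀ n, Ω → ℤ → E n) (X' : ∀ n, Ω' → ℤ → E n),
    (∀ n, IsTProcess T (X n)) ∧ (∀ n, IsTProcess T' (X' n)) ∧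
    (∀ n, F n = generated P X n) ∧ (∀ n, F' n = generated P' X' n) ∧
    P.map (fun ω n => X n ω) = P'.map (fun ω n => X' n ω)

/-- `F` is immersed in `G`: `F n ⊆ G n` for `n ≤ 0`, and for `n ≤ -1` the sigma-algebras `F (n + 1)`
and `G n` are independent conditionally to `F n`. -/
def Immersed [StandardBorelSpace Ω] (P : Measure Ω) [IsProbabilityMeasure P]
    (F G : NegTime → MeasurableSpace Ω) : Prop :=
  (∀ n, F n ≤ G n) ∧
  ∀ n n' : NegTime, (n' : ℤ) = n + 1 →
    ∃ hn : F n ≤ mΩ, CondIndep (F n) (F n') (G n) hn P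

/-- The factor filtration `(F, T)` is dynamically of product type. -/
def IsDynProductType (P : Measure Ω) (T : Ω ≃ᵐ Ω) (F : NegTime → MeasurableSpace Ω) : Prop :=
  IsFactorFiltration P T F ∧
  ∃ G : NegTime → MeasurableSpace Ω, (∀ n, IsFactorAlgebra P T (G n)) ∧ iIndep G P ∧
    ∀ n, F n = ⨆ (m : NegTime) (_ : m ≤ n), G m

/-- The factor filtration `(F, T)` is dynamically immersible in the factor filtration `(G, S)`. -/
def DynImmersible [StandardBorelSpace Ω'] (P : Measure Ω) (T : Ω ≃ᵐ Ω)
    (F : NegTime → MeasurableSpace Ω) (Q : Measure Ω') [IsProbabilityMeasure Q] (S : Ω' ≃ᵐ Ω')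
    (G : NegTime → MeasurableSpace Ω') : Prop :=
  ∃ F' : NegTime → MeasurableSpace Ω',
    IsFactorFiltration Q S F' ∧ Immersed Q F' G ∧ DynIsomorphic P T F Q S F'

/-- `(F, T)` is a factor filtration that is dynamically standard: it is dynamically immersible in
some factor filtration dynamically of product type. (Every standard Borel space is
isomorphic to one in `Type`, so the universe of `Ω'` is no restriction.) -/
def IsDynStandard (P : Measure Ω) (T : Ω ≃ᵐ Ω) (F : NegTime → MeasurableSpace Ω) : Prop :=
  IsFactorFiltration P T F ∧
  ∃ (Ω' : Type) (_ : MeasurableSpace Ω') (_ : StandardBorelSpace Ω')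
    (Q : Measure Ω') (_ : IsProbabilityMeasure Q) (S : Ω' ≃ᵐ Ω')
    (G : NegTime → MeasurableSpace Ω'),
    IsDynProductType Q S G ∧ DynImmersible P T F Q S G

end Abstract

section Automaton

variable (A : Type u) [AddCommGroup A] [Fintype A] [MeasurableSpace A]
  [DiscreteMeasurableSpace A]

/-- The uniform product measure on configurations. -/
noncomputable def uniformConfig : Measure (ℤ → A) :=
  Measure.infinitePi fun _ => (PMF.uniformOfFintype A).toMeasure

variable {A}

/-- The deterministic cellular automaton `τ x (i) = x(i) + x(i + 1)`. -/
def tau (x : ℤ → A) : ℤ → A := fun i => x i + x (i + 1)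

open Classical in
/-- The law of the error in one cell: `0` with probability `1 - ε`, and each `a ≠ 0` with
probability `ε / (|A| - 1)`. -/
noncomputable def errorLaw (A : Type u) [AddCommGroup A] [Fintype A] [MeasurableSpace A]
    (ε : ℝ) : Measure A :=
  ENNReal.ofReal (1 - ε) • Measure.dirac 0 +
    ∑ a ∈ Finset.univ.erase (0 : A),
      ENNReal.ofReal (ε / ((Fintype.card A : ℝ) - 1)) • Measure.dirac a

theorem measurable_tau_add :
    Measurable fun p : (ℤ → A) × (ℤ → A) => tau p.1 + p.2 := by
  refine measurable_pi_lambda _ fun i => ?_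
  have h : Measurable fun q : A × A × A => q.1 + q.2.1 + q.2.2 := measurable_of_countable _
  have h' : Measurable fun p : (ℤ → A) × (ℤ → A) => (p.1 i, p.1 (i + 1), p.2 i) :=
    ((measurable_pi_apply i).comp measurable_fst).prodMk
      (((measurable_pi_apply (i + 1)).comp measurable_fst).prodMk
        ((measurable_pi_apply i).comp measurable_snd))
  exact h.comp h'

/-- The probabilistic cellular automaton `τ_ε`: the Markov kernel sending `x` to the law of
`τ x + ξ`, the errors `ξ(i)`, `i ∈ ℤ`, being independent with law `errorLaw A ε`. -/
noncomputable def pca (ε : ℝ) : Kernel (ℤ → A) (ℤ → A) :=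
  ((Kernel.id : Kernel (ℤ → A) (ℤ → A)) ×ₖ
    Kernel.const (ℤ → A) (Measure.infinitePi fun _ : ℤ => errorLaw A ε)).map
    fun p => tau p.1 + p.2

/-- `(X n)_{n ∈ ℤ}` is, on `(Ω, P)`, a stationary Markov chain with transition kernel `τ_ε`, each
`X n` following the uniform product law: given `(X m)_{m ≤ n}`, the conditional law of `X (n + 1)`
is `τ_ε (X n, ·)`. -/
structure IsStationaryChain {Ω : Type*} [MeasurableSpace Ω] (ε : ℝ) (P : Measure Ω)
    (X : ℤ → Ω → ℤ → A) : Prop where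
  measurable : ∀ n, Measurable (X n)
  law : ∀ n, P.map (X n) = uniformConfig A
  transition : ∀ n : ℤ, HasCondDistrib (X (n + 1)) (fun ω (m : Set.Iic n) => X m ω)
    ((pca ε).comap (fun p : Set.Iic n → ℤ → A => p ⟨n, le_refl n⟩) (measurable_pi_apply _)) P

/-- The left shift of the space coordinate on `(A^ℤ)^ℤ`: `(σ x)_n(i) = x_n(i + 1)`. -/
def shift (A : Type u) [MeasurableSpace A] : (ℤ → ℤ → A) ≃ᵐ (ℤ → ℤ → A) where
  toFun x n i := x n (i + 1)
  invFun x n i := x n (i - 1)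
  left_inv x := by ext n i; simp
  right_inv x := by ext n i; simp
  measurable_toFun := measurable_pi_lambda _ fun n => measurable_pi_lambda _ fun i =>
    (measurable_pi_apply (i + 1)).comp (measurable_pi_apply n)
  measurable_invFun := measurable_pi_lambda _ fun n => measurable_pi_lambda _ fun i =>
    (measurable_pi_apply (i - 1)).comp (measurable_pi_apply n)

/-- The canonical process on `(A^ℤ)^ℤ`. -/
def coord (A : Type u) (n : ℤ) (x : ℤ → ℤ → A) : ℤ → A := x n

/-- The filtration generated on `(A^ℤ)^ℤ` by the negative-time part of the canonical process. -/
@[reducible]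
def canonicalFiltration (P : Measure (ℤ → ℤ → A)) : NegTime → MeasurableSpace (ℤ → ℤ → A) :=
  generated P fun n : NegTime => coord A n

end Automaton

end FactorFiltrations

/-! Put r = (|A|-1)/|A| and p = ε/r. The noise is a mixture: with probability p a cell receives a
uniform error, with probability 1-p none. A uniform error makes the new value uniform whatever the
neighbours were, so it can be replaced by drawing the value itself afresh. The automaton is
therefore driven by i.i.d. letters (flag, uniform value): a cell whose flag is on takes the letter's
value, any other cell applies `tau` (`isUpdateRule_flagValueLaw`).

The value of a cell can remain undetermined by the letters only if its flag is off and one of its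
two parents is undetermined. This is a branching process of mean at most 2(1-p), subcritical when p
> 1/2, that is ε > r/2. Hence, almost surely, running the automaton from ever earlier times
stabilises in every cell (`IsUpdateRule.ae_stable`), and the limit `eventualValue` is a function of
past letters that commutes with the spatial shift. The uniform measure is invariant under the kernel
(`bind_pca_uniformConfig`), so the limit is a stationary chain with the required marginals
(`IsUpdateRule.isStationaryChain`). Any such chain has the same law, since its one-time law and
kernel fix the finite-dimensional laws (`IsStationaryChain.unique`).

The filtration of the letters is dynamically of product type. The chain moves from n to n+1 using
only its present state and the letters at n+1, which are independent of all earlier letters; this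
gives immersion (`IsUpdateRule.immersed`) and hence standardness. -/

namespace FactorFiltrations

universe u v

/-! ### Completions, factor sigma-algebras and T-processes -/

section Abstract

variable {Ω : Type u} {m m' : MeasurableSpace Ω} {mΩ : MeasurableSpace Ω} {P : Measure Ω}
  {T : Ω ≃ᵐ Ω}

theorem measurableSet_completion_iff {s : Set Ω} :
    MeasurableSet[completion P m] s ↔
      (∃ t, MeasurableSet[m] t ∧ s =ᵐ[P] t) ∧ MeasurableSet[mΩ] s :=
  MeasurableSpace.measurableSet_inf

theorem completion_le : completion P m ≤ mΩ := inf_le_right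

theorem le_completion (hm : m ≤ mΩ) : m ≤ completion P m :=
  fun s hs => measurableSet_completion_iff.2 ⟨⟨s, hs, Filter.EventuallyEq.rfl⟩, hm s hs⟩

/-- The two differences between `s` and `t` are null, hence in `m` by completeness, and `s` is
rebuilt from them and `t`. -/
theorem IsFactorAlgebra.measurableSet_of_ae_eq (h : IsFactorAlgebra P T m)
    {s t : Set Ω} (hs : MeasurableSet[mΩ] s) (ht : MeasurableSet[m] t) (hst : s =ᵐ[P] t) :
    MeasurableSet[m] s := by
  have h1 : MeasurableSet[m] (t \ s) :=
    h.complete _ ((h.le t ht).diff hs) (ae_le_set.1 hst.symm.le)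
  have h2 : MeasurableSet[m] (s \ t) :=
    h.complete _ (hs.diff (h.le t ht)) (ae_le_set.1 hst.le)
  have h3 : s = (t \ (t \ s)) ∪ (s \ t) := by
    ext x; simp only [Set.mem_union, Set.mem_sdiff]; tauto
  rw [h3]
  exact (ht.diff h1).union h2

theorem IsFactorAlgebra.completion_le (h : IsFactorAlgebra P T m')
    (hm : m ≤ m') : completion P m ≤ m' := by
  intro s hs
  obtain ⟨⟨t, ht, hst⟩, hs'⟩ := measurableSet_completion_iff.1 hs
  exact h.measurableSet_of_ae_eq hs' (hm t ht) hst

theorem completion_mono (h : m ≤ m') :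
    completion P m ≤ completion P m' := by
  intro s hs
  obtain ⟨⟨t, ht, hst⟩, hs'⟩ := measurableSet_completion_iff.1 hs
  exact measurableSet_completion_iff.2 ⟨⟨t, h t ht, hst⟩, hs'⟩

theorem isFactorAlgebra_completion (hT : MeasurePreserving T P P) (h : m.comap T ≤ m)
    (h' : m.comap T.symm ≤ m) :
    IsFactorAlgebra P T (completion P m) where
  le := FactorFiltrations.completion_le
  complete s hs h0 := (measurableSet_completion_iff (P := P) (m := m) (s := s)).2
    ⟨⟨∅, @MeasurableSet.empty _ m, ae_eq_empty.2 h0⟩, hs⟩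
  preimage s hs := by
    obtain ⟨⟨t, ht, hst⟩, hs'⟩ := measurableSet_completion_iff.1 hs
    exact measurableSet_completion_iff.2 ⟨⟨T ⁻¹' t, h _ ⟨t, ht, rfl⟩,
      hT.quasiMeasurePreserving.preimage_ae_eq hst⟩, T.measurable hs'⟩
  image s hs := by
    obtain ⟨⟨t, ht, hst⟩, hs'⟩ := measurableSet_completion_iff.1 hs
    have hT' : MeasurePreserving T.symm P P := hT.symm T
    rw [T.image_eq_preimage_symm]
    exact measurableSet_completion_iff.2 ⟨⟨T.symm ⁻¹' t, h' _ ⟨t, ht, rfl⟩,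
      hT'.quasiMeasurePreserving.preimage_ae_eq hst⟩, T.symm.measurable hs'⟩

theorem isFactorAlgebra_iSup {ι : Type*} [Nonempty ι] {m : ι → MeasurableSpace Ω}
    (h : ∀ i, IsFactorAlgebra P T (m i)) : IsFactorAlgebra P T (⨆ i, m i) where
  le := iSup_le fun i => (h i).le
  complete s hs h0 :=
    (le_iSup m (Classical.arbitrary ι)) s ((h (Classical.arbitrary ι)).complete s hs h0)
  preimage s hs := by
    have : (⨆ i, m i).comap T ≤ ⨆ i, m i := by
      rw [MeasurableSpace.comap_iSup]
      refine iSup_mono fun i => ?_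
      rintro _ ⟨t, ht, rfl⟩
      exact (h i).preimage t ht
    exact this _ ⟨s, hs, rfl⟩
  image s hs := by
    have : (⨆ i, m i).comap T.symm ≤ ⨆ i, m i := by
      rw [MeasurableSpace.comap_iSup]
      refine iSup_mono fun i => ?_
      rintro _ ⟨t, ht, rfl⟩
      rw [← T.image_eq_preimage_symm]
      exact (h i).image t ht
    rw [T.image_eq_preimage_symm]
    exact this _ ⟨s, hs, rfl⟩

theorem IsTProcess.apply_map {E : Type*} [MeasurableSpace E] {X : Ω → ℤ → E}
    (h : IsTProcess T X) (ω : Ω) (i : ℤ) : X (T ω) i = X ω (i + 1) := by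
  rw [h.eq_comp, h.eq_comp (i + 1), zpow_add_one]
  rfl

theorem IsTProcess.apply_symm {E : Type*} [MeasurableSpace E] {X : Ω → ℤ → E}
    (h : IsTProcess T X) (ω : Ω) (i : ℤ) : X (T.symm ω) i = X ω (i - 1) := by
  have := h.apply_map (T.symm ω) (i - 1)
  simpa using this.symm

theorem isTProcess_of_apply_map {E : Type*} [MeasurableSpace E] {X : Ω → ℤ → E}
    (hX : Measurable X) (h : ∀ ω i, X (T ω) i = X ω (i + 1)) : IsTProcess T X where
  measurable := hX
  eq_comp i := by
    -- The induction on the power needs the point and the site free, because each step moves both.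
    have key : ∀ (i : ℤ) (ω : Ω) (j : ℤ),
        X (((T.toEquiv : Equiv.Perm Ω) ^ i) ω) j = X ω (j + i) := by
      intro i
      induction i with
      | zero => intro ω j; simp
      | succ i ih =>
        intro ω j
        rw [zpow_add_one, Equiv.Perm.mul_apply, ih]
        change X (T ω) _ = _
        rw [h, add_assoc]
      | pred i ih =>
        intro ω j
        rw [zpow_sub_one, Equiv.Perm.mul_apply, ih]
        have h2 := h (T.symm ω) (j + (-(i : ℤ) - 1))
        rw [T.apply_symm_apply] at h2
        rw [h2]
        change X (T.symm ω) _ = _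
        congr 1; ring
    intro ω
    rw [key, zero_add]

theorem IsTProcess.comap_comap_le {E : Type*} [MeasurableSpace E] {X : Ω → ℤ → E}
    (h : IsTProcess T X) :
    (MeasurableSpace.comap X inferInstance).comap T ≤ MeasurableSpace.comap X inferInstance := by
  rintro _ ⟨_, ⟨s, hs, rfl⟩, rfl⟩
  refine ⟨(fun x i => x (i + 1)) ⁻¹' s, ?_, ?_⟩
  · exact (measurable_pi_lambda _ fun i => measurable_pi_apply (i + 1)) hs
  · ext ω
    have : (fun i => X ω (i + 1)) = X (T ω) := funext fun i => (h.apply_map ω i).symm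
    simp [this]

theorem IsTProcess.comap_symm_comap_le {E : Type*} [MeasurableSpace E] {X : Ω → ℤ → E}
    (h : IsTProcess T X) :
    (MeasurableSpace.comap X inferInstance).comap T.symm ≤
      MeasurableSpace.comap X inferInstance := by
  rintro _ ⟨_, ⟨s, hs, rfl⟩, rfl⟩
  refine ⟨(fun x i => x (i - 1)) ⁻¹' s, ?_, ?_⟩
  · exact (measurable_pi_lambda _ fun i => measurable_pi_apply (i - 1)) hs
  · ext ω
    have : (fun i => X ω (i - 1)) = X (T.symm ω) := funext fun i => (h.apply_symm ω i).symm
    simp [this]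

theorem IsTProcess.isFactorAlgebra {E : Type*} [MeasurableSpace E] {X : Ω → ℤ → E}
    (h : IsTProcess T X) (hT : MeasurePreserving T P P) :
    IsFactorAlgebra P T (completion P (MeasurableSpace.comap X inferInstance)) :=
  isFactorAlgebra_completion hT h.comap_comap_le h.comap_symm_comap_le

theorem isFactorFiltration_generated [IsProbabilityMeasure P] {E : NegTime → Type*}
    [∀ n, MeasurableSpace (E n)] {X : ∀ n, Ω → ℤ → E n} (h : ∀ n, IsTProcess T (X n))
    (hT : MeasurePreserving T P P) : IsFactorFiltration P T (generated P X) where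
  isProbabilityMeasure := inferInstance
  measurePreserving := hT
  mono a b hab := completion_mono (iSup₂_mono' fun m hm => ⟨m, hm.trans hab, le_rfl⟩)
  factor n := by
    refine isFactorAlgebra_completion hT ?_ ?_
    · simp only [MeasurableSpace.comap_iSup]
      exact iSup₂_mono fun m _ => (h m).comap_comap_le
    · simp only [MeasurableSpace.comap_iSup]
      exact iSup₂_mono fun m _ => (h m).comap_symm_comap_le

theorem iIndep_completion [IsProbabilityMeasure P] {ι : Type*} {m : ι → MeasurableSpace Ω}
    (h : iIndep m P) : iIndep (fun i => completion P (m i)) P := by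
  rw [iIndep_iff] at h ⊢
  intro s f hf
  choose! g hg hfg using fun i hi => (measurableSet_completion_iff.1 (hf i hi)).1
  have hfg' : (⋂ i ∈ s, f i) =ᵐ[P] ⋂ i ∈ s, g i :=
    Filter.EventuallyEq.countable_bInter s.countable_toSet hfg
  rw [measure_congr hfg', h s hg]
  exact Finset.prod_congr rfl fun i hi => (measure_congr (hfg i hi)).symm

end Abstract

/-! ### Conditional independence created by an independent innovation -/

section ConditionalIndependence

variable {Ω : Type u} {m F G U : MeasurableSpace Ω} {mΩ : MeasurableSpace Ω} [StandardBorelSpace Ω]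
  {P : Measure Ω} [IsProbabilityMeasure P]

omit [StandardBorelSpace Ω] in
-- Conditioning on the larger `G` first turns the independent event `t` into the constant `P.real
-- t`; the tower property then descends to `F`.
theorem condExp_indicator_inter_of_indep (hF : F ≤ G) (hG : G ≤ mΩ) (hU : U ≤ mΩ)
    (h : Indep U G P) {t s : Set Ω} (ht : MeasurableSet[U] t) (hs : MeasurableSet[G] s) :
    P[(t ∩ s).indicator (fun _ => (1 : ℝ)) | F] =ᵐ[P]
      fun ω => P.real t * (P[s.indicator (fun _ => (1 : ℝ)) | F]) ω := by
  have h1 : P[(t ∩ s).indicator (fun _ => (1 : ℝ)) | G] =ᵐ[P]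
      P.real t • s.indicator (fun _ => (1 : ℝ)) := by
    have e : (t ∩ s).indicator (fun _ => (1 : ℝ)) =
        s.indicator (t.indicator fun _ => (1 : ℝ)) := by
      rw [Set.indicator_indicator, Set.inter_comm]
    have h2 : P[t.indicator (fun _ => (1 : ℝ)) | G] =ᵐ[P] fun _ => P.real t := by
      have := condExp_indep_eq (m₁ := U) (m₂ := G) (μ := P)
        (f := t.indicator (fun _ => (1 : ℝ))) hU hG
        ((@stronglyMeasurable_const _ _ U _ (1 : ℝ)).indicator ht) h
      rwa [integral_indicator_const _ (hU t ht), smul_eq_mul, mul_one] at this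
    rw [e]
    refine (condExp_indicator ((integrable_const (1 : ℝ)).indicator (hU t ht)) hs).trans ?_
    filter_upwards [h2] with ω hω
    by_cases hωs : ω ∈ s <;> simp [hωs, hω]
  refine (condExp_condExp_of_le hF hG).symm.trans ((condExp_congr_ae h1).trans ?_)
  exact condExp_smul _ _ F

/-- The source of immersion, with `U` the new letters and `G` the old ones. On the pi-system of sets
`s ∩ t` generating `F ⊔ U`, the event `s` is known to `F` and `t` contributes only a constant
factor. -/
theorem condIndep_sup_of_indep (hF : F ≤ G) (hG : G ≤ mΩ) (hU : U ≤ mΩ) (h : Indep U G P) :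
    CondIndep F (F ⊔ U) G (hF.trans hG) P := by
  have hsup : F ⊔ U ≤ mΩ := sup_le (hF.trans hG) hU
  refine CondIndepSets.condIndep (p1 := {r | ∃ s t, MeasurableSet[F] s ∧ MeasurableSet[U] t ∧
    r = s ∩ t}) (p2 := {s | MeasurableSet[G] s}) hsup hG ?_ ?_ ?_ ?_ ?_
  · rintro _ ⟨s, t, hs, ht, rfl⟩ _ ⟨s', t', hs', ht', rfl⟩ -
    exact ⟨s ∩ s', t ∩ t', hs.inter hs', ht.inter ht', by rw [Set.inter_inter_inter_comm]⟩
  · exact @MeasurableSpace.isPiSystem_measurableSet _ G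
  · refine le_antisymm (sup_le ?_ ?_) (MeasurableSpace.generateFrom_le ?_)
    · exact fun s hs => MeasurableSpace.measurableSet_generateFrom
        ⟨s, Set.univ, hs, MeasurableSet.univ, by simp⟩
    · exact fun t ht => MeasurableSpace.measurableSet_generateFrom
        ⟨Set.univ, t, MeasurableSet.univ, ht, by simp⟩
    · rintro _ ⟨s, t, hs, ht, rfl⟩
      exact MeasurableSet.inter ((le_sup_left : F ≤ F ⊔ U) s hs) ((le_sup_right : U ≤ F ⊔ U) t ht)
  · exact (@MeasurableSpace.generateFrom_measurableSet _ G).symm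
  · rw [condIndepSets_iff]
    · rintro _ s' ⟨s, t, hs, ht, rfl⟩ hs'
      have key : ∀ r : Set Ω, MeasurableSet[G] r →
          P[(s ∩ t ∩ r).indicator (fun _ => (1 : ℝ)) | F] =ᵐ[P]
          s.indicator fun ω => P.real t * (P[r.indicator (fun _ => (1 : ℝ)) | F]) ω := by
        intro r hr
        rw [Set.inter_assoc, ← Set.indicator_indicator]
        refine (condExp_indicator ((integrable_const (1 : ℝ)).indicator
          ((hU t ht).inter (hG r hr))) hs).trans ?_
        filter_upwards [condExp_indicator_inter_of_indep hF hG hU h ht hr] with ω hω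
        by_cases hωs : ω ∈ s <;> simp [hωs, hω]
      have h1 := key Set.univ MeasurableSet.univ
      rw [Set.inter_univ, Set.indicator_univ, condExp_const (hF.trans hG)] at h1
      filter_upwards [h1, key s' hs'] with ω hω hω'
      rw [hω', Pi.mul_apply, hω]
      by_cases hωs : ω ∈ s <;> simp [hωs]
    · rintro _ ⟨s, t, hs, ht, rfl⟩
      exact (hF.trans hG s hs).inter (hU t ht)
    · exact fun s hs => hG s hs

theorem condIndep_completion_left {hF : F ≤ mΩ} (hm : m ≤ mΩ) (hG : G ≤ mΩ)
    (h : CondIndep F m G hF P) : CondIndep F (completion P m) G hF P := by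
  rw [condIndep_iff F _ G hF hm hG P] at h
  rw [condIndep_iff F _ G hF completion_le hG P]
  intro s r hs hr
  obtain ⟨⟨t, ht, hst⟩, -⟩ := measurableSet_completion_iff.1 hs
  have h1 : (s ∩ r).indicator (fun _ => (1 : ℝ)) =ᵐ[P] (t ∩ r).indicator fun _ => (1 : ℝ) :=
    indicator_ae_eq_of_ae_eq_set (hst.inter Filter.EventuallyEq.rfl)
  have h2 : s.indicator (fun _ => (1 : ℝ)) =ᵐ[P] t.indicator fun _ => (1 : ℝ) :=
    indicator_ae_eq_of_ae_eq_set hst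
  exact (condExp_congr_ae h1).trans ((h t r ht hr).trans
    ((condExp_congr_ae h2).symm.mul Filter.EventuallyEq.rfl))

end ConditionalIndependence

/-! ### Uniqueness of the law of the stationary chain -/

section Uniqueness

variable {A : Type u} [AddCommGroup A] [Fintype A] [MeasurableSpace A] [DiscreteMeasurableSpace A]

instance {ε : ℝ} [IsProbabilityMeasure (errorLaw A ε)] : IsMarkovKernel (pca (A := A) ε) := by
  unfold pca
  exact Kernel.IsMarkovKernel.map _ measurable_tau_add

theorem pca_apply {ε : ℝ} [IsProbabilityMeasure (errorLaw A ε)] (x : ℤ → A) :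
    pca ε x = (Measure.infinitePi fun _ : ℤ => errorLaw A ε).map fun ξ => tau x + ξ := by
  have hm : Measurable fun p : (ℤ → A) × (ℤ → A) => tau p.1 + p.2 := measurable_tau_add
  rw [pca, Kernel.map_apply _ hm, Kernel.prod_apply, Kernel.id_apply, Kernel.const_apply,
    Measure.dirac_prod, Measure.map_map hm measurable_prodMk_left]
  rfl

instance : IsProbabilityMeasure (uniformConfig A) := by
  unfold uniformConfig; infer_instance

omit [DiscreteMeasurableSpace A] in
theorem IsStationaryChain.isProbabilityMeasure {Ω : Type*} [MeasurableSpace Ω] {ε : ℝ}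
    {P : Measure Ω} {X : ℤ → Ω → ℤ → A} (h : IsStationaryChain ε P X) :
    IsProbabilityMeasure P := by
  have : IsProbabilityMeasure (P.map (X 0)) := by rw [h.law 0]; infer_instance
  exact Measure.isProbabilityMeasure_of_map (X 0)

/-- The trajectory `x` frozen outside of the time interval `[n, n + k]`. -/
def clampTime (n : ℤ) (k : ℕ) (x : ℤ → ℤ → A) : ℤ → ℤ → A := fun m => x (max n (min m (n + k)))

omit [AddCommGroup A] [Fintype A] [DiscreteMeasurableSpace A] in
theorem measurable_clampTime (n : ℤ) (k : ℕ) : Measurable (clampTime (A := A) n k) :=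
  measurable_pi_lambda _ fun _ => measurable_pi_apply _

/-- The frozen trajectory is a function of the past up to n + k that keeps the state at n + k, the
only one the kernel reads; so the transition property given the whole past descends to it. -/
theorem IsStationaryChain.map_clampTime_succ {ε : ℝ} [IsProbabilityMeasure (errorLaw A ε)]
    {P : Measure (ℤ → ℤ → A)} (h : IsStationaryChain ε P (coord A)) (n : ℤ) (k : ℕ) :
    P.map (fun x => (clampTime n k x, x (n + k + 1))) =
      P.map (clampTime n k) ⊗ₘ (pca ε).comap (fun y : ℤ → ℤ → A => y (n + k))
        (measurable_pi_apply _) := by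
  have := h.isProbabilityMeasure
  let f : (Set.Iic (n + k : ℤ) → ℤ → A) → ℤ → ℤ → A :=
    fun p m => p ⟨max n (min m (n + k)), by simp⟩
  have hf : Measurable f := measurable_pi_lambda _ fun m => measurable_pi_apply _
  have hk : (pca ε).comap (fun p : Set.Iic (n + k : ℤ) → ℤ → A => p ⟨n + k, Set.mem_Iic.2 le_rfl⟩)
      (measurable_pi_apply (⟨n + k, Set.mem_Iic.2 le_rfl⟩ : Set.Iic (n + k : ℤ))) =
      ((pca ε).comap (fun y : ℤ → ℤ → A => y (n + k))
        (measurable_pi_apply _)).comap f hf := by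
    ext1 p
    simp only [Kernel.comap_apply, f]
    congr 2
    simp
  have ht := h.transition (n + k)
  rw [hk] at ht
  exact ht.comp_right.map_eq

theorem IsStationaryChain.map_clampTime_eq {ε : ℝ} [IsProbabilityMeasure (errorLaw A ε)]
    {P P' : Measure (ℤ → ℤ → A)} (h : IsStationaryChain ε P (coord A))
    (h' : IsStationaryChain ε P' (coord A)) (n : ℤ) (k : ℕ) :
    P.map (clampTime n k) = P'.map (clampTime n k) := by
  induction k with
  | zero =>
    have hm : Measurable fun (y : ℤ → A) (_ : ℤ) => y := measurable_pi_lambda _ fun _ => measurable_id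
    have e : clampTime (A := A) n 0 = (fun y _ => y) ∘ coord A n := by
      ext x m i
      simp [clampTime, coord]
    rw [e, ← Measure.map_map hm (h.measurable n), ← Measure.map_map hm (h'.measurable n), h.law,
      h'.law]
  | succ k ih =>
    -- Gluing the new state at all times after n + k gives the trajectory frozen one step later.
    let g : (ℤ → ℤ → A) × (ℤ → A) → ℤ → ℤ → A := fun p m => if m ≤ n + k then p.1 m else p.2
    have hg : Measurable g := by
      refine measurable_pi_lambda _ fun m => ?_
      by_cases hm : m ≤ n + k
      · simpa [g, hm, Function.comp_def] using (measurable_pi_apply m).comp measurable_fst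
      · simpa [g, hm] using measurable_snd
    have hp : Measurable fun x : ℤ → ℤ → A => (clampTime n k x, x (n + k + 1)) :=
      (measurable_clampTime n k).prodMk (measurable_pi_apply _)
    have e : clampTime (A := A) n (k + 1) = g ∘ fun x => (clampTime n k x, x (n + k + 1)) := by
      ext x m i
      simp only [clampTime, g, Function.comp_apply]
      split_ifs with hm
      · congr 2; push_cast; omega
      · congr 2; push_cast; omega
    rw [e, ← Measure.map_map hg hp, ← Measure.map_map hg hp, h.map_clampTime_succ,
      h'.map_clampTime_succ, ih]

theorem IsStationaryChain.unique {ε : ℝ} [IsProbabilityMeasure (errorLaw A ε)]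
    {P P' : Measure (ℤ → ℤ → A)} (h : IsStationaryChain ε P (coord A))
    (h' : IsStationaryChain ε P' (coord A)) : P = P' := by
  have := h.isProbabilityMeasure
  have := h'.isProbabilityMeasure
  have key : ∀ J : Finset ℤ, P.map J.restrict = P'.map J.restrict := by
    intro J
    let N := J.sup Int.natAbs
    -- All times of `J` lie in [-N, N], where freezing changes nothing.
    have e : J.restrict (π := fun _ => ℤ → A) = J.restrict ∘ clampTime (-N) (2 * N) := by
      ext x ⟨j, hj⟩ i
      have : j.natAbs ≤ N := Finset.le_sup (f := Int.natAbs) hj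
      simp only [Finset.restrict, clampTime, Function.comp_apply]
      congr 2; push_cast; omega
    rw [e, ← Measure.map_map (Finset.measurable_restrict J) (measurable_clampTime _ _),
      ← Measure.map_map (Finset.measurable_restrict J) (measurable_clampTime _ _),
      h.map_clampTime_eq h']
  have (J : Finset ℤ) : IsProbabilityMeasure (P'.map (J.restrict (π := fun _ => ℤ → A))) :=
    Measure.isProbabilityMeasure_map (Finset.measurable_restrict J).aemeasurable
  exact IsProjectiveLimit.unique (P := fun J : Finset ℤ => P'.map J.restrict) key fun _ => rfl

end Uniqueness

/-! ### Invariance of the uniform measure under the automaton -/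

section UniformInvariance

/-- The convolution of the two measures equals each of them, by the translation invariance of that
one. -/
theorem eq_of_map_add_eq {H : Type*} [AddCommGroup H] [MeasurableSpace H] [MeasurableAdd₂ H]
    {μ ν : Measure H} [IsProbabilityMeasure μ] [IsProbabilityMeasure ν]
    (hμ : ∀ y, μ.map (y + ·) = μ) (hν : ∀ y, ν.map (y + ·) = ν) : μ = ν := by
  have key : ∀ {μ ν : Measure H} [IsProbabilityMeasure μ] [IsProbabilityMeasure ν],
      (∀ y, ν.map (y + ·) = ν) → (μ.prod ν).map (fun p => p.1 + p.2) = ν := by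
    intro μ ν _ _ hν
    ext s hs
    have hm : Measurable fun p : H × H => p.1 + p.2 := measurable_add
    rw [Measure.map_apply hm hs, Measure.prod_apply (hm hs)]
    have : ∀ x, ν (Prod.mk x ⁻¹' ((fun p : H × H => p.1 + p.2) ⁻¹' s)) = ν s := fun x => by
      conv_rhs => rw [← hν x, Measure.map_apply (measurable_const_add x) hs]
      rfl
    simp [this]
  rw [← key (μ := μ) hν, ← Measure.prod_swap, Measure.map_map measurable_add measurable_swap]
  conv_lhs => rw [← key (μ := ν) hμ]
  congr 1
  ext p
  exact add_comm _ _

variable {A : Type u} [AddCommGroup A] [Fintype A] [MeasurableSpace A] [DiscreteMeasurableSpace A]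

theorem toMeasure_uniformOfFintype_map_equiv {B C : Type*} [Fintype B] [Nonempty B]
    [MeasurableSpace B] [DiscreteMeasurableSpace B] [Fintype C] [Nonempty C]
    [MeasurableSpace C] [DiscreteMeasurableSpace C] (e : B ≃ C) :
    (PMF.uniformOfFintype B).toMeasure.map e = (PMF.uniformOfFintype C).toMeasure := by
  refine Measure.ext_of_singleton fun c => ?_
  rw [Measure.map_apply (measurable_of_countable e) (.singleton c),
    PMF.toMeasure_apply_singleton _ _ (.singleton c)]
  have : e ⁻¹' {c} = {e.symm c} := by ext b; simp [Equiv.eq_symm_apply]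
  rw [this, PMF.toMeasure_apply_singleton _ _ (.singleton _)]
  simp [Fintype.card_congr e]

theorem map_add_uniformConfig (y : ℤ → A) : (uniformConfig A).map (y + ·) = uniformConfig A := by
  have h := Measure.infinitePi_map_pi (fun _ : ℤ => (PMF.uniformOfFintype A).toMeasure)
    (f := fun i a => y i + a) fun i => measurable_of_countable _
  refine h.trans ?_
  unfold uniformConfig
  congr 1
  ext1 i
  exact toMeasure_uniformOfFintype_map_equiv (Equiv.addLeft (y i))

omit [Fintype A] [MeasurableSpace A] [DiscreteMeasurableSpace A] in
theorem tau_surjective : Function.Surjective (tau (A := A)) := by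
  intro y
  -- A preimage with value 0 at the origin is found by solving the recurrence in both directions: `r
  -- n` is its value at n, `l n` its value at -n.
  let r : ℕ → A := fun n => Nat.rec 0 (fun n a => y n - a) n
  let l : ℕ → A := fun n => Nat.rec 0 (fun n a => y (-(n : ℤ) - 1) - a) n
  refine ⟨fun i => if 0 ≤ i then r i.toNat else l (-i).toNat, ?_⟩
  ext i
  simp only [tau]
  rcases le_or_gt 0 i with hi | hi
  · lift i to ℕ using hi
    have e : ((i : ℤ) + 1).toNat = i + 1 := by omega
    rw [if_pos (by omega), if_pos (by omega), e, Int.toNat_natCast]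
    change r i + (y i - r i) = y i
    abel
  · obtain ⟨n, rfl⟩ : ∃ n : ℕ, i = -(n : ℤ) - 1 := ⟨(-i - 1).toNat, by omega⟩
    have e : (-(-(n : ℤ) - 1)).toNat = n + 1 := by omega
    rw [if_neg (by omega), e]
    have hs : l (n + 1) = y (-(n : ℤ) - 1) - l n := rfl
    rcases Nat.eq_zero_or_pos n with rfl | hn
    · rw [if_pos (by simp), hs]
      simp [l, r]
    · have e' : (-(-(n : ℤ) - 1 + 1)).toNat = n := by omega
      rw [if_neg (by omega), e', hs]
      abel

omit [Fintype A] [MeasurableSpace A] [DiscreteMeasurableSpace A] in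
theorem tau_add (x y : ℤ → A) : tau (x + y) = tau x + tau y := by
  ext i
  simp only [tau, Pi.add_apply]
  abel

theorem measurable_tau : Measurable (tau (A := A)) := by
  have := (measurable_tau_add (A := A)).comp (measurable_id.prodMk (measurable_const (a := 0)))
  simpa [Function.comp_def] using this

/-- Translating the input by `z` translates the output by `tau z`. As `tau` is onto, the output law
is invariant under every translation, which characterises the uniform measure. -/
theorem bind_pca_uniformConfig {ε : ℝ} [IsProbabilityMeasure (errorLaw A ε)] :
    (uniformConfig A).bind (pca ε) = uniformConfig A := by
  refine eq_of_map_add_eq (fun y => ?_) map_add_uniformConfig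
  obtain ⟨z, rfl⟩ := tau_surjective y
  ext s hs
  have hm := measurable_const_add (tau z)
  rw [Measure.map_apply hm hs, Measure.bind_apply (hm hs) (Kernel.aemeasurable _),
    Measure.bind_apply hs (Kernel.aemeasurable _)]
  conv_rhs => rw [← map_add_uniformConfig z,
    lintegral_map (Kernel.measurable_coe _ hs) (measurable_const_add _)]
  refine lintegral_congr fun x => ?_
  rw [pca_apply, pca_apply, Measure.map_apply (measurable_const_add _) (hm hs),
    Measure.map_apply (measurable_const_add _) hs, tau_add]
  congr 1
  ext ξ
  simp [add_assoc]

end UniformInvariance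

/-! ### Construction of the chain from independent letters -/

section Coupling

variable {A : Type u} [AddCommGroup A] [Fintype A] [MeasurableSpace A] [DiscreteMeasurableSpace A]
  {L : Type v} [MeasurableSpace L] {ε : ℝ} {ν : Measure L} {b : L → Bool} {v : L → A}

/-- With `l` of law `ν`, the random map `c ↦ if b l then v l else c` adds to its argument an error
of law `errorLaw A ε`; the value `v l` is uniform, and it is used with probability greater than
one half. -/
structure IsUpdateRule (ε : ℝ) (ν : Measure L) (b : L → Bool) (v : L → A) : Prop where
  isProbabilityMeasure : IsProbabilityMeasure ν
  measurable_flag : Measurable b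
  measurable_value : Measurable v
  map_value : ν.map v = (PMF.uniformOfFintype A).toMeasure
  map_update : ∀ c, ν.map (fun l => if b l then v l else c) = (errorLaw A ε).map (c + ·)
  two_mul_lt : 2 * ν {l | b l = false} < 1

/-- One step of the automaton, driven by the letters `l`. -/
def update (b : L → Bool) (v : L → A) (l : ℤ → L) (x : ℤ → A) : ℤ → A :=
  fun i => if b (l i) then v (l i) else tau x i

/-- The configuration at time `n` obtained from the letters `u` by `k` steps of the automaton. -/
def approx (b : L → Bool) (v : L → A) : ℕ → (ℤ → ℤ → L) → ℤ → ℤ → A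
  | 0, u, n => fun i => v (u n i)
  | k + 1, u, n => update b v (u n) (approx b v k u (n - 1))

open Classical in
/-- The eventual value of `approx b v k u n i` as `k → ∞`, and `0` if there is none. -/
noncomputable def eventualValue (b : L → Bool) (v : L → A) (u : ℤ → ℤ → L) (n i : ℤ) : A :=
  ∑ a : A, if ∀ᶠ k in Filter.atTop, approx b v k u n i = a then a else 0

omit [MeasurableSpace A] [DiscreteMeasurableSpace A] [MeasurableSpace L] in
theorem eventualValue_eq {u : ℤ → ℤ → L} {n i : ℤ} {a : A}
    (h : ∀ᶠ k in Filter.atTop, approx b v k u n i = a) : eventualValue b v u n i = a := by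
  rw [eventualValue, Finset.sum_eq_single a, if_pos h]
  · intro c _ hc
    rw [if_neg]
    intro h'
    obtain ⟨k, hk, hk'⟩ := (h.and h').exists
    exact hc (hk'.symm.trans hk)
  · simp

omit [MeasurableSpace A] [DiscreteMeasurableSpace A] [MeasurableSpace L] in
theorem eventually_eq_eventualValue {u : ℤ → ℤ → L} {n i : ℤ}
    (h : ∃ a, ∀ᶠ k in Filter.atTop, approx b v k u n i = a) :
    ∀ᶠ k in Filter.atTop, approx b v k u n i = eventualValue b v u n i := by
  obtain ⟨a, ha⟩ := h
  rwa [eventualValue_eq ha]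

omit [Fintype A] [MeasurableSpace A] [DiscreteMeasurableSpace A] [MeasurableSpace L] in
theorem update_shift (l : ℤ → L) (x : ℤ → A) (i : ℤ) :
    update b v (fun j => l (j + 1)) (fun j => x (j + 1)) i = update b v l x (i + 1) := rfl

omit [Fintype A] [MeasurableSpace A] [DiscreteMeasurableSpace A] in
theorem approx_shift (k : ℕ) (u : ℤ → ℤ → L) (n i : ℤ) :
    approx b v k (shift L u) n i = approx b v k u n (i + 1) := by
  induction k generalizing n i with
  | zero => rfl
  | succ k ih =>
    rw [approx, approx, ← update_shift]
    congr 1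
    ext j
    exact ih _ _

omit [MeasurableSpace A] [DiscreteMeasurableSpace A] in
theorem eventualValue_shift (u : ℤ → ℤ → L) (n i : ℤ) :
    eventualValue b v (shift L u) n i = eventualValue b v u n (i + 1) := by
  classical
  exact Finset.sum_congr rfl fun a _ => if_congr (by simp only [approx_shift]) rfl rfl

/-- The sigma-algebra of the letters up to time `n`. -/
@[reducible]
def past (L : Type v) [MeasurableSpace L] (n : ℤ) : MeasurableSpace (ℤ → ℤ → L) :=
  ⨆ (m : ℤ) (_ : m ≤ n), MeasurableSpace.comap (coord L m) inferInstance

theorem past_mono : Monotone (past L) := fun _ _ h =>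
  iSup₂_mono' fun m hm => ⟨m, hm.trans h, le_rfl⟩

theorem measurable_coord (n : ℤ) : Measurable (coord L n) := measurable_pi_apply n

theorem past_le (n : ℤ) : past L n ≤ MeasurableSpace.pi :=
  iSup₂_le fun m _ => (measurable_coord m).comap_le

theorem measurable_coord_past (n : ℤ) : Measurable[past L n] (coord L n) :=
  measurable_iff_comap_le.2 (le_iSup₂_of_le n le_rfl le_rfl)

theorem measurable_update (hb : Measurable b) (hv : Measurable v) :
    Measurable fun p : (ℤ → L) × (ℤ → A) => update b v p.1 p.2 := by
  refine measurable_pi_lambda _ fun i => ?_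
  have h1 : Measurable fun p : (ℤ → L) × (ℤ → A) => p.1 i :=
    (measurable_pi_apply i).comp measurable_fst
  refine Measurable.ite ((hb.comp h1) (measurableSet_singleton true)) (hv.comp h1) ?_
  exact (measurable_pi_apply i).comp (measurable_tau.comp measurable_snd)

theorem measurable_approx (hb : Measurable b) (hv : Measurable v) (k : ℕ) (n : ℤ) :
    Measurable[past L n] fun u => approx b v k u n := by
  induction k generalizing n with
  | zero =>
    exact (measurable_pi_lambda _ fun i => hv.comp (measurable_pi_apply i)).comp
      (measurable_coord_past n)
  | succ k ih =>
    exact (measurable_update hb hv).comp ((measurable_coord_past n).prodMk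
      ((ih (n - 1)).mono (past_mono (by omega)) le_rfl))

theorem measurableSet_eventually_approx (hb : Measurable b) (hv : Measurable v) (n i : ℤ) (a : A) :
    MeasurableSet[past L n] {u | ∀ᶠ k in Filter.atTop, approx b v k u n i = a} := by
  simp only [Filter.eventually_atTop, Set.ofPred_exists, Set.ofPred_forall]
  refine MeasurableSet.iUnion fun N => MeasurableSet.iInter fun k => MeasurableSet.iInter fun _ => ?_
  exact ((measurable_pi_apply i).comp (measurable_approx hb hv k n)) (measurableSet_singleton a)

theorem measurable_eventualValue (hb : Measurable b) (hv : Measurable v) (n : ℤ) :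
    Measurable[past L n] fun u => eventualValue b v u n := by
  refine @measurable_pi_lambda _ _ _ (past L n) _ _ fun i => ?_
  refine Finset.measurable_fun_sum _ fun a _ => ?_
  exact Measurable.ite (measurableSet_eventually_approx hb hv n i a) measurable_const
    measurable_const

theorem measurable_eventualValue_pi (hb : Measurable b) (hv : Measurable v) :
    Measurable (eventualValue b v) :=
  measurable_pi_lambda _ fun n => (measurable_eventualValue hb hv n).mono (past_le n) le_rfl

/-- The law of an independent array of letters. -/
noncomputable def letterLaw (ν : Measure L) : Measure (ℤ → ℤ → L) :=
  Measure.infinitePi fun _ => Measure.infinitePi fun _ => ν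

instance [IsProbabilityMeasure ν] : IsProbabilityMeasure (letterLaw ν) := by
  unfold letterLaw; infer_instance

theorem iIndep_comap_coord [IsProbabilityMeasure ν] :
    iIndep (fun n => MeasurableSpace.comap (coord L n) inferInstance) (letterLaw ν) :=
  iIndepFun_infinitePi (P := fun _ : ℤ => Measure.infinitePi fun _ : ℤ => ν)
    (X := fun _ => id) fun _ => measurable_id

theorem indep_comap_coord_past [IsProbabilityMeasure ν] {m n : ℤ} (h : m < n) :
    Indep (MeasurableSpace.comap (coord L n) inferInstance) (past L m) (letterLaw ν) := by
  have := indep_iSup_of_disjoint (fun n => (measurable_coord (L := L) n).comap_le)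
    (iIndep_comap_coord (ν := ν)) (S := {n}) (T := Set.Iic m)
    (Set.disjoint_singleton_left.2 (by simpa using h))
  simpa using this

theorem map_coord_letterLaw [IsProbabilityMeasure ν] (n : ℤ) :
    (letterLaw ν).map (coord L n) = Measure.infinitePi fun _ => ν :=
  Measure.infinitePi_map_eval (fun _ : ℤ => Measure.infinitePi fun _ : ℤ => ν) n

theorem map_prodMk_coord [IsProbabilityMeasure ν] {E : Type*} [MeasurableSpace E]
    {m n : ℤ} (h : m < n) {X : (ℤ → ℤ → L) → E} (hX : Measurable[past L m] X) :
    (letterLaw ν).map (fun u => (X u, coord L n u)) =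
      ((letterLaw ν).map X).prod (Measure.infinitePi fun _ => ν) := by
  have hi : IndepFun X (coord L n) (letterLaw ν) := by
    rw [IndepFun_iff_Indep]
    exact (indep_of_indep_of_le_right (indep_comap_coord_past h)
      (measurable_iff_comap_le.1 hX)).symm
  rw [(indepFun_iff_map_prod_eq_prod_map_map (hX.mono (past_le m) le_rfl).aemeasurable
    (measurable_coord n).aemeasurable).1 hi, map_coord_letterLaw]

/-- Translates a representation by independent noise into a statement about the kernel. -/
theorem map_prod_eq_compProd {E F N : Type*} [MeasurableSpace E] [MeasurableSpace F]
    [MeasurableSpace N] {μ : Measure E} [SFinite μ] {ρ : Measure N} [SFinite ρ] {κ : Kernel E F}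
    [IsSFiniteKernel κ] {f : E → N → F} (hf : Measurable fun p : E × N => f p.1 p.2)
    (h : ∀ x, ρ.map (f x) = κ x) :
    (μ.prod ρ).map (fun p => (p.1, f p.1 p.2)) = μ ⊗ₘ κ := by
  have hm : Measurable fun p : E × N => (p.1, f p.1 p.2) := measurable_fst.prodMk hf
  ext s hs
  rw [Measure.map_apply hm hs, Measure.prod_apply (hm hs), Measure.compProd_apply hs]
  refine lintegral_congr fun x => ?_
  have hfx : Measurable (f x) := hf.comp measurable_prodMk_left
  rw [← h x, Measure.map_apply hfx (measurable_prodMk_left hs)]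
  rfl

omit [DiscreteMeasurableSpace A] in
theorem IsUpdateRule.isProbabilityMeasure_errorLaw (h : IsUpdateRule ε ν b v) :
    IsProbabilityMeasure (errorLaw A ε) := by
  have := h.isProbabilityMeasure
  have h0 := h.map_update 0
  simp only [zero_add, Measure.map_id'] at h0
  rw [← h0]
  refine Measure.isProbabilityMeasure_map (Measurable.ite
    (h.measurable_flag (measurableSet_singleton true)) h.measurable_value
    measurable_const).aemeasurable

theorem IsUpdateRule.map_update_eq_pca (h : IsUpdateRule ε ν b v) (x : ℤ → A) :
    (Measure.infinitePi fun _ => ν).map (fun l => update b v l x) = pca ε x := by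
  have := h.isProbabilityMeasure
  have := h.isProbabilityMeasure_errorLaw
  rw [pca_apply]
  have h1 := Measure.infinitePi_map_pi (fun _ : ℤ => ν)
    (f := fun i l => if b l then v l else tau x i) fun i => Measurable.ite
      (h.measurable_flag (measurableSet_singleton true)) h.measurable_value measurable_const
  have h2 := Measure.infinitePi_map_pi (fun _ : ℤ => errorLaw A ε)
    (f := fun i a => tau x i + a) fun i => measurable_of_countable _
  refine h1.trans (Eq.trans ?_ h2.symm)
  congr 1
  ext1 i
  exact h.map_update _

/-- The start is uniform because the letter values are. Each further step uses letters independent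
of the configuration it acts on, so it applies the kernel, which preserves the uniform measure. -/
theorem IsUpdateRule.map_approx (h : IsUpdateRule ε ν b v) (k : ℕ) (n : ℤ) :
    (letterLaw ν).map (fun u => approx b v k u n) = uniformConfig A := by
  have := h.isProbabilityMeasure
  have := h.isProbabilityMeasure_errorLaw
  induction k generalizing n with
  | zero =>
    have hm : Measurable fun (l : ℤ → L) i => v (l i) :=
      measurable_pi_lambda _ fun i => h.measurable_value.comp (measurable_pi_apply i)
    change (letterLaw ν).map ((fun l i => v (l i)) ∘ coord L n) = _
    rw [← Measure.map_map hm (measurable_coord n), map_coord_letterLaw,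
      Measure.infinitePi_map_pi _ fun _ => h.measurable_value]
    simp only [h.map_value]
    rfl
  | succ k ih =>
    have hX := measurable_approx h.measurable_flag h.measurable_value k (n - 1)
    have hu : Measurable fun p : (ℤ → A) × (ℤ → L) => update b v p.2 p.1 :=
      (measurable_update h.measurable_flag h.measurable_value).comp measurable_swap
    have hXu : Measurable fun u => (approx b v k u (n - 1), coord L n u) :=
      (hX.mono (past_le _) le_rfl).prodMk (measurable_coord n)
    change (letterLaw ν).map ((fun p : (ℤ → A) × (ℤ → L) => update b v p.2 p.1) ∘
      fun u => (approx b v k u (n - 1), coord L n u)) = _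
    rw [← Measure.map_map hu hXu, map_prodMk_coord (by omega) hX, ih]
    have hs := map_prod_eq_compProd (μ := uniformConfig A) (f := fun x l => update b v l x) hu
      h.map_update_eq_pca
    have e : (fun p : (ℤ → A) × (ℤ → L) => update b v p.2 p.1) =
        Prod.snd ∘ fun p => (p.1, update b v p.2 p.1) := rfl
    rw [e, ← Measure.map_map measurable_snd (measurable_fst.prodMk hu), hs]
    exact (Measure.snd_compProd _ _).trans bind_pca_uniformConfig

/-- Subcriticality as a one-step contraction: the supremum over all cells of the probability of not
stabilising is at most itself times a factor below 1. -/
theorem IsUpdateRule.ae_stable (h : IsUpdateRule ε ν b v) :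
    ∀ᵐ u ∂letterLaw ν, ∀ n i, ∃ a, ∀ᶠ k in Filter.atTop, approx b v k u n i = a := by
  have := h.isProbabilityMeasure
  let S : ℤ → ℤ → Set (ℤ → ℤ → L) :=
    fun n i => {u | ¬ ∃ a, ∀ᶠ k in Filter.atTop, approx b v k u n i = a}
  have hS : ∀ n i, MeasurableSet[past L n] (S n i) := fun n i => by
    have e : S n i = (⋃ a, {u | ∀ᶠ k in Filter.atTop, approx b v k u n i = a})ᶜ := by
      ext u; simp [S]
    rw [e]
    exact MeasurableSet.compl <| MeasurableSet.iUnion fun a =>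
      measurableSet_eventually_approx h.measurable_flag h.measurable_value n i a
  let D : ℤ → ℤ → Set (ℤ → ℤ → L) := fun n i => coord L n ⁻¹' {l | b (l i) = false}
  have hD0 : ∀ i, MeasurableSet {l : ℤ → L | b (l i) = false} := fun i =>
    (h.measurable_flag.comp (measurable_pi_apply i)) (measurableSet_singleton false)
  have hD : ∀ n i, letterLaw ν (D n i) = ν {l | b l = false} := by
    intro n i
    rw [← Measure.map_apply (measurable_coord n) (hD0 i), map_coord_letterLaw]
    exact (measurePreserving_eval_infinitePi (fun _ : ℤ => ν) i).measure_preimage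
      (h.measurable_flag (measurableSet_singleton false)).nullMeasurableSet
  -- With its flag on, a cell is constant in `k` from `k = 0`, since the initial stage also reads
  -- `v`. With its flag off, it stabilises once both parents do.
  have hsub : ∀ n i, S n i ⊆ D n i ∩ (S (n - 1) i ∪ S (n - 1) (i + 1)) := by
    intro n i u hu
    have hb : b (u n i) = false := by
      by_contra hb
      refine hu ⟨v (u n i), ?_⟩
      refine Filter.Eventually.of_forall fun k => ?_
      cases k with
      | zero => rfl
      | succ k => simp [approx, update, hb]
    refine ⟨hb, ?_⟩
    by_contra hc
    simp only [S, Set.mem_union, Set.mem_ofPred_eq, not_or, not_not] at hc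
    obtain ⟨⟨a, ha⟩, ⟨c, hc⟩⟩ := hc
    refine hu ⟨a + c, ?_⟩
    rw [← Filter.map_add_atTop_eq_nat 1, Filter.eventually_map]
    filter_upwards [ha, hc] with k hk hk'
    simp [approx, update, hb, tau, hk, hk']
  let s : ENNReal := ⨆ (n) (i), letterLaw ν (S n i)
  have hle : ∀ n i, letterLaw ν (S n i) ≤ s := fun n i =>
    le_iSup₂ (f := fun n i => letterLaw ν (S n i)) n i
  have hs1 : s ≤ 1 := iSup₂_le fun _ _ => prob_le_one
  -- The flag at time n is independent of the parents' events, which depend on letters up to n - 1;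
  -- the 2 is the union bound over the parents.
  have hs : s ≤ 2 * ν {l | b l = false} * s := by
    refine iSup₂_le fun n i => (measure_mono (hsub n i)).trans ?_
    rw [(Indep_iff _ _ _).1 (indep_comap_coord_past (ν := ν) (sub_one_lt n)) _ _ ⟨_, hD0 i, rfl⟩
      ((hS _ _).union (hS _ _)), hD, mul_comm 2, mul_assoc]
    gcongr
    exact (measure_union_le _ _).trans ((add_le_add (hle _ _) (hle _ _)).trans_eq (two_mul s).symm)
  have hs0 : s = 0 := by
    by_contra h0
    have hlt : 2 * ν {l | b l = false} * s < 1 * s :=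
      ENNReal.mul_lt_mul_left h0 (ne_top_of_le_ne_top ENNReal.one_ne_top hs1) h.two_mul_lt
    exact absurd (hs.trans_lt hlt) (by simp)
  rw [ae_all_iff]
  intro n
  rw [ae_all_iff]
  intro i
  exact le_antisymm ((hle n i).trans hs0.le) zero_le

theorem IsUpdateRule.ae_eventualValue_eq_update (h : IsUpdateRule ε ν b v) :
    ∀ᵐ u ∂letterLaw ν, ∀ n,
      eventualValue b v u (n + 1) = update b v (u (n + 1)) (eventualValue b v u n) := by
  filter_upwards [h.ae_stable] with u hu n
  ext i
  refine eventualValue_eq ?_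
  rw [← Filter.map_add_atTop_eq_nat 1, Filter.eventually_map]
  filter_upwards [eventually_eq_eventualValue (hu n i),
    eventually_eq_eventualValue (hu n (i + 1))] with k hk hk'
  simp [approx, update, tau, hk, hk']

/-- A cylinder involves finitely many cells, so almost surely its indicator along the approximations
is eventually that of the limit; their laws are all uniform. -/
theorem IsUpdateRule.map_eventualValue (h : IsUpdateRule ε ν b v) (n : ℤ) :
    (letterLaw ν).map (fun u => eventualValue b v u n) = uniformConfig A := by
  have := h.isProbabilityMeasure
  have hX : Measurable fun u => eventualValue b v u n :=
    (measurable_eventualValue h.measurable_flag h.measurable_value n).mono (past_le n) le_rfl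
  have hZ : ∀ k, Measurable fun u => approx b v k u n := fun k =>
    (measurable_approx h.measurable_flag h.measurable_value k n).mono (past_le n) le_rfl
  refine Measure.eq_infinitePi _ fun s t ht => ?_
  have hst : MeasurableSet ((s : Set ℤ).pi t) := .pi s.countable_toSet fun i _ => ht i
  rw [Measure.map_apply hX hst]
  have hlim := tendsto_measure_of_ae_tendsto_indicator_of_isFiniteMeasure Filter.atTop
    (A := (fun u => eventualValue b v u n) ⁻¹' (s : Set ℤ).pi t)
    (As := fun k => (fun u => approx b v k u n) ⁻¹' (s : Set ℤ).pi t) (μ := letterLaw ν)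
    (hX hst) (fun k => hZ k hst) ?_
  · refine tendsto_nhds_unique hlim ?_
    simp_rw [← Measure.map_apply (hZ _) hst, h.map_approx]
    rw [uniformConfig, Measure.infinitePi_pi _ fun i _ => ht i]
    exact tendsto_const_nhds
  · filter_upwards [h.ae_stable] with u hu
    have : ∀ᶠ k in Filter.atTop, ∀ i ∈ s, approx b v k u n i = eventualValue b v u n i :=
      (Filter.eventually_all_finset s).2 fun i _ => eventually_eq_eventualValue (hu n i)
    filter_upwards [this] with k hk
    exact forall₂_congr fun i hi => by simp only [hk i hi]

/-- The states up to n depend only on letters up to n, hence are independent of the letters at n + 1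
that drive the next update. -/
theorem IsUpdateRule.isStationaryChain (h : IsUpdateRule ε ν b v) :
    IsStationaryChain ε ((letterLaw ν).map (eventualValue b v)) (coord A) := by
  have := h.isProbabilityMeasure
  have := h.isProbabilityMeasure_errorLaw
  have hX := measurable_eventualValue_pi h.measurable_flag h.measurable_value
  refine ⟨measurable_coord, fun n => ?_, fun n => ?_⟩
  · rw [Measure.map_map (measurable_coord n) hX]
    exact h.map_eventualValue n
  · let Y : (ℤ → ℤ → L) → Set.Iic n → ℤ → A := fun u m => eventualValue b v u m
    have hY : Measurable[past L n] Y := @measurable_pi_lambda _ _ _ (past L n) _ _ fun m =>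
      (measurable_eventualValue h.measurable_flag h.measurable_value m).mono (past_mono m.2) le_rfl
    have hr : Measurable fun (x : ℤ → ℤ → A) (m : Set.Iic n) => coord A m x :=
      measurable_pi_lambda _ fun m => measurable_pi_apply _
    have hf : Measurable fun p : (Set.Iic n → ℤ → A) × (ℤ → L) =>
        update b v p.2 (p.1 ⟨n, le_refl n⟩) :=
      (measurable_update h.measurable_flag h.measurable_value).comp
        (measurable_snd.prodMk ((measurable_pi_apply _).comp measurable_fst))
    refine ⟨(hr.prodMk (measurable_coord (n + 1))).aemeasurable, ?_⟩
    rw [Measure.map_map (hr.prodMk (measurable_coord (n + 1))) hX, Measure.map_map hr hX]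
    change _ = (letterLaw ν).map Y ⊗ₘ _
    rw [← map_prod_eq_compProd (ρ := Measure.infinitePi fun _ : ℤ => ν)
      (f := fun p l => update b v l (p ⟨n, le_refl n⟩)) hf
      fun x => h.map_update_eq_pca (x ⟨n, le_refl n⟩), ← map_prodMk_coord (lt_add_one n) hY,
      Measure.map_map (measurable_fst.prodMk hf)
        ((hY.mono (past_le n) le_rfl).prodMk (measurable_coord _))]
    refine Measure.map_congr ?_
    filter_upwards [h.ae_eventualValue_eq_update] with u hu
    exact Prod.ext rfl (hu n)

end Coupling

/-! ### Immersion into the filtration of the letters -/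

section Standardness

variable {A : Type u} [AddCommGroup A] [Fintype A] [MeasurableSpace A] [DiscreteMeasurableSpace A]
  {ε : ℝ}

theorem measurePreserving_shift {L : Type v} [MeasurableSpace L] {ν : Measure L}
    [IsProbabilityMeasure ν] : MeasurePreserving (shift L) (letterLaw ν) (letterLaw ν) := by
  refine ⟨(shift L).measurable, ?_⟩
  have hm : Measurable fun (l : ℤ → L) i => l (i + 1) :=
    measurable_pi_lambda _ fun i => measurable_pi_apply (i + 1)
  have h1 : (Measure.infinitePi fun _ : ℤ => ν).map (fun l i => l (i + 1)) =
      Measure.infinitePi fun _ : ℤ => ν :=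
    Measure.map_infinitePi_infinitePi_of_inj (P := fun _ : ℤ => ν) (add_left_injective 1)
  have h2 := Measure.infinitePi_map_pi (fun _ : ℤ => Measure.infinitePi fun _ : ℤ => ν)
    (f := fun _ l i => l (i + 1)) fun _ => hm
  simp only [h1] at h2
  exact h2

theorem isTProcess_coord {L : Type v} [MeasurableSpace L] (n : ℤ) :
    IsTProcess (shift L) (coord L n) :=
  isTProcess_of_apply_map (measurable_coord n) fun _ _ => rfl

variable {L : Type} [MeasurableSpace L] {ν : Measure L} {b : L → Bool} {v : L → A}

/-- The completed sigma-algebra of the letters at time `n`. -/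
@[reducible]
noncomputable def letterAlgebra (ν : Measure L) (n : NegTime) : MeasurableSpace (ℤ → ℤ → L) :=
  completion (letterLaw ν) (MeasurableSpace.comap (coord L n) inferInstance)

theorem isFactorAlgebra_letterAlgebra [IsProbabilityMeasure ν] (n : NegTime) :
    IsFactorAlgebra (letterLaw ν) (shift L) (letterAlgebra ν n) :=
  (isTProcess_coord (n : ℤ)).isFactorAlgebra measurePreserving_shift

theorem iIndep_letterAlgebra [IsProbabilityMeasure ν] :
    iIndep (letterAlgebra ν) (letterLaw ν) :=
  iIndep_completion ((iIndep_comap_coord (ν := ν)).precomp Subtype.val_injective)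

/-- The filtration of the letters. -/
@[reducible]
noncomputable def letterFiltration (ν : Measure L) (n : NegTime) : MeasurableSpace (ℤ → ℤ → L) :=
  ⨆ (m : NegTime) (_ : m ≤ n), letterAlgebra ν m

theorem isFactorAlgebra_letterFiltration [IsProbabilityMeasure ν] (n : NegTime) :
    IsFactorAlgebra (letterLaw ν) (shift L) (letterFiltration ν n) := by
  rw [letterFiltration, iSup_subtype']
  have : Nonempty {m : NegTime // m ≤ n} := ⟨⟨n, le_rfl⟩⟩
  exact isFactorAlgebra_iSup fun m => isFactorAlgebra_letterAlgebra m.1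

theorem isDynProductType_letterFiltration [IsProbabilityMeasure ν] :
    IsDynProductType (letterLaw ν) (shift L) (letterFiltration ν) :=
  ⟨{ isProbabilityMeasure := inferInstance
     measurePreserving := measurePreserving_shift
     mono := fun _ _ hab => iSup₂_mono' fun m hm => ⟨m, hm.trans hab, le_rfl⟩
     factor := isFactorAlgebra_letterFiltration },
   letterAlgebra ν, isFactorAlgebra_letterAlgebra, iIndep_letterAlgebra, fun _ => rfl⟩

theorem past_le_letterFiltration (n : NegTime) : past L n ≤ letterFiltration ν n :=
  iSup₂_le fun m hm => le_iSup₂_of_le (f := fun (m : NegTime) (_ : m ≤ n) => letterAlgebra ν m)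
    ⟨m, hm.trans n.2⟩ hm (le_completion (measurable_coord m).comap_le)

/-- The configurations at negative times, as functions of the letters. -/
noncomputable def negEventualValue (b : L → Bool) (v : L → A) (n : NegTime)
    (u : ℤ → ℤ → L) : ℤ → A := eventualValue b v u n

theorem IsUpdateRule.isTProcess_negEventualValue (h : IsUpdateRule ε ν b v) (n : NegTime) :
    IsTProcess (shift L) (negEventualValue b v n) :=
  isTProcess_of_apply_map
    ((measurable_eventualValue h.measurable_flag h.measurable_value n).mono (past_le _) le_rfl)
    fun u i => eventualValue_shift u n i

/-- The state at n + 1 is the update of the state at n by the new letters. The recursion holds only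
almost surely, whence the outer completion. -/
theorem IsUpdateRule.comap_le_generated_sup (h : IsUpdateRule ε ν b v) {m n n' : NegTime}
    (hn : (n' : ℤ) = n + 1) (hm : m ≤ n') :
    MeasurableSpace.comap (negEventualValue b v m) inferInstance ≤ completion (letterLaw ν)
      (generated (letterLaw ν) (negEventualValue b v) n ⊔ letterAlgebra ν n') := by
  have hX : ∀ m ≤ n, MeasurableSpace.comap (negEventualValue b v m) inferInstance ≤
      generated (letterLaw ν) (negEventualValue b v) n := fun m hm =>
    (le_iSup₂_of_le (f := fun (m : NegTime) (_ : m ≤ n) =>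
      MeasurableSpace.comap (negEventualValue b v m) inferInstance) m hm le_rfl).trans
      (le_completion (iSup₂_le fun m _ => (h.isTProcess_negEventualValue m).measurable.comap_le))
  have hsup : generated (letterLaw ν) (negEventualValue b v) n ⊔ letterAlgebra ν n' ≤
    MeasurableSpace.pi := sup_le completion_le completion_le
  rcases hm.lt_or_eq with hlt | rfl
  · have hmn : m ≤ n := by
      have : (m : ℤ) < n' := hlt
      exact Subtype.coe_le_coe.1 (by omega)
    exact (hX m hmn).trans (le_sup_left.trans (le_completion hsup))
  · rintro _ ⟨s, hs, rfl⟩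
    have h1 : Measurable[generated (letterLaw ν) (negEventualValue b v) n ⊔ letterAlgebra ν m]
        (coord L m) := measurable_iff_comap_le.2
      ((le_completion (P := letterLaw ν) (measurable_coord (m : ℤ)).comap_le).trans le_sup_right)
    have h2 : Measurable[generated (letterLaw ν) (negEventualValue b v) n ⊔ letterAlgebra ν m]
        (negEventualValue b v n) := measurable_iff_comap_le.2 ((hX n le_rfl).trans le_sup_left)
    have hu := (measurable_update h.measurable_flag h.measurable_value).comp (h1.prodMk h2)
    refine measurableSet_completion_iff.2 ⟨⟨_, hu hs, ?_⟩, (h.isTProcess_negEventualValue m).measurable hs⟩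
    filter_upwards [h.ae_eventualValue_eq_update] with u hu
    have e : negEventualValue b v m u = update b v (coord L m u) (negEventualValue b v n u) := by
      simp only [negEventualValue, coord, hn]
      exact hu n
    exact congrArg (· ∈ s) e

theorem IsUpdateRule.generated_le (h : IsUpdateRule ε ν b v) (n : NegTime) :
    generated (letterLaw ν) (negEventualValue b v) n ≤ letterFiltration ν n := by
  have := h.isProbabilityMeasure
  refine (isFactorAlgebra_letterFiltration n).completion_le (iSup₂_le fun m hm => ?_)
  exact (measurable_iff_comap_le.1 (measurable_eventualValue h.measurable_flag h.measurable_value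
    m)).trans ((past_mono hm).trans (past_le_letterFiltration n))

theorem IsUpdateRule.immersed [StandardBorelSpace L] [IsProbabilityMeasure ν]
    (h : IsUpdateRule ε ν b v) :
    Immersed (letterLaw ν) (generated (letterLaw ν) (negEventualValue b v))
      (letterFiltration ν) := by
  refine ⟨h.generated_le, fun n n' hn => ⟨completion_le, ?_⟩⟩
  have hG := (isFactorAlgebra_letterFiltration (ν := ν) n).le
  have hi : Indep (letterAlgebra ν n') (letterFiltration ν n) (letterLaw ν) := by
    have := indep_iSup_of_disjoint (fun n => (isFactorAlgebra_letterAlgebra (ν := ν) n).le)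
      iIndep_letterAlgebra (S := {n'}) (T := Set.Iic n) (Set.disjoint_singleton_left.2 fun hle => by
        have : (n' : ℤ) ≤ n := hle
        omega)
    simpa using this
  -- Two completions are absorbed: one from the almost sure recursion, one from the definition of
  -- `generated`.
  refine condIndep_of_condIndep_of_le_left (condIndep_completion_left (completion_le)
    hG (condIndep_completion_left (sup_le completion_le completion_le) hG
      (condIndep_sup_of_indep (h.generated_le n) hG completion_le hi)))
    (completion_mono (iSup₂_le fun m hm => h.comap_le_generated_sup hn hm))

/-- The canonical process under the pushforward law and `negEventualValue` under the letters have
the same law by construction, which gives the dynamical isomorphism. -/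
theorem IsUpdateRule.isDynStandard [StandardBorelSpace L] (h : IsUpdateRule ε ν b v) :
    IsDynStandard ((letterLaw ν).map (eventualValue b v)) (shift A)
      (canonicalFiltration ((letterLaw ν).map (eventualValue b v))) := by
  have := h.isProbabilityMeasure
  have hX := measurable_eventualValue_pi h.measurable_flag h.measurable_value
  have hP : IsProbabilityMeasure ((letterLaw ν).map (eventualValue b v)) :=
    Measure.isProbabilityMeasure_map hX.aemeasurable
  have hS : MeasurePreserving (shift A) ((letterLaw ν).map (eventualValue b v))
      ((letterLaw ν).map (eventualValue b v)) := by
    refine ⟨(shift A).measurable, ?_⟩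
    conv_rhs => rw [← (measurePreserving_shift (ν := ν)).map_eq,
      Measure.map_map hX (shift L).measurable]
    rw [Measure.map_map (shift A).measurable hX]
    congr 1
    ext u n i
    exact (eventualValue_shift u n i).symm
  refine ⟨isFactorFiltration_generated (fun n => isTProcess_coord (n : ℤ)) hS, ?_⟩
  refine ⟨ℤ → ℤ → L, inferInstance, inferInstance, letterLaw ν, inferInstance, shift L,
    letterFiltration ν, isDynProductType_letterFiltration,
    generated (letterLaw ν) (negEventualValue b v),
    isFactorFiltration_generated h.isTProcess_negEventualValue measurePreserving_shift, h.immersed, ?_⟩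
  refine ⟨fun _ => A, fun _ => inferInstance, fun _ => inferInstance, fun n => coord A n,
    negEventualValue b v, fun n => isTProcess_coord (n : ℤ), h.isTProcess_negEventualValue, fun _ => rfl,
    fun _ => rfl, ?_⟩
  rw [Measure.map_map (measurable_pi_lambda _ fun n => measurable_coord _) hX]
  rfl

end Standardness

/-! ### Decomposition of the error law into resampling and no error -/

section Rule

variable {A : Type u} [AddCommGroup A] [Fintype A] [MeasurableSpace A] [DiscreteMeasurableSpace A]

theorem errorLaw_singleton (ε : ℝ) (a : A) [Decidable (a = 0)] :
    errorLaw A ε {a} =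
      ENNReal.ofReal (if a = 0 then 1 - ε else ε / ((Fintype.card A : ℝ) - 1)) := by
  classical
  simp only [errorLaw, Measure.add_apply, Measure.smul_apply, Measure.finsetSum_apply,
    Measure.dirac_apply' _ (measurableSet_singleton a), smul_eq_mul, Set.indicator_apply,
    Set.mem_singleton_iff, Pi.one_apply, mul_ite, mul_one, mul_zero]
  by_cases h : a = 0 <;> simp [h, eq_comm]

/-- The law of a flag that is `true` with probability `p`, together with a uniform value. -/
noncomputable def flagValueLaw (B : Type*) [Fintype B] [Nonempty B] [MeasurableSpace B] (p : ℝ) :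
    Measure (Bool × B) :=
  (ENNReal.ofReal (1 - p) • Measure.dirac false + ENNReal.ofReal p • Measure.dirac true).prod
    (PMF.uniformOfFintype B).toMeasure

/-- With q = |A|, the updated value is c with probability (1 - p) + p/q = 1 - ε and any other given
value with probability p/q = ε/(q - 1). The copy `B` of `A` frees the letters from the universe of
`A`. -/
theorem isUpdateRule_flagValueLaw [Nontrivial A] {B : Type v} [Fintype B] [Nonempty B]
    [MeasurableSpace B] [DiscreteMeasurableSpace B] (e : B ≃ A) {p ε : ℝ} (hp : 1 / 2 < p)
    (hp1 : p ≤ 1) (hε : ε = p * (((Fintype.card A : ℝ) - 1) / Fintype.card A)) :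
    IsUpdateRule ε (flagValueLaw B p) Prod.fst (fun l => e l.2) := by
  have hq : (1 : ℝ) < Fintype.card A := by exact_mod_cast Fintype.one_lt_card
  have hflag : IsProbabilityMeasure
      (ENNReal.ofReal (1 - p) • Measure.dirac false + ENNReal.ofReal p • Measure.dirac true) := by
    refine ⟨?_⟩
    simp only [Measure.add_apply, Measure.smul_apply, measure_univ, smul_eq_mul, mul_one]
    rw [← ENNReal.ofReal_add (by linarith) (by linarith)]
    simp
  have he : Measurable e := measurable_of_countable _
  refine ⟨by unfold flagValueLaw; infer_instance, measurable_fst, he.comp measurable_snd, ?_, ?_, ?_⟩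
  · change (flagValueLaw B p).map (e ∘ Prod.snd) = _
    rw [← Measure.map_map he measurable_snd]
    have : (flagValueLaw B p).map Prod.snd = (PMF.uniformOfFintype B).toMeasure :=
      (Measure.snd_prod (ν := (PMF.uniformOfFintype B).toMeasure))
    rw [this, toMeasure_uniformOfFintype_map_equiv]
  · intro c
    classical
    have hm : Measurable fun l : Bool × B => if l.1 then e l.2 else c :=
      Measurable.ite (measurable_fst (measurableSet_singleton true)) (he.comp measurable_snd)
        measurable_const
    refine Measure.ext_of_singleton fun a => ?_
    rw [Measure.map_apply hm (.singleton a), Measure.map_apply (measurable_const_add c)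
      (.singleton a), flagValueLaw, Measure.prod_apply (hm (.singleton a)), lintegral_add_measure,
      lintegral_smul_measure, lintegral_smul_measure, lintegral_dirac, lintegral_dirac]
    have h1 : (c + ·) ⁻¹' {a} = {a - c} := by
      ext d; simp only [Set.mem_preimage, Set.mem_singleton_iff, eq_sub_iff_add_eq, add_comm c]
    have h2 : Prod.mk true ⁻¹' ((fun l : Bool × B => if l.1 then e l.2 else c) ⁻¹' {a}) =
        {e.symm a} := by
      ext d; simp [Equiv.eq_symm_apply]
    have h3 : Prod.mk false ⁻¹' ((fun l : Bool × B => if l.1 then e l.2 else c) ⁻¹' {a}) =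
        if a = c then Set.univ else ∅ := by
      ext d; split_ifs with h <;> simp [h, Ne.symm]
    have hc : ((Fintype.card B : ENNReal))⁻¹ = ENNReal.ofReal ((Fintype.card A : ℝ)⁻¹) := by
      rw [Fintype.card_congr e, ENNReal.ofReal_inv_of_pos (by linarith), ENNReal.ofReal_natCast]
    rw [h1, h2, h3, errorLaw_singleton, PMF.toMeasure_apply_singleton _ _ (.singleton _),
      PMF.uniformOfFintype_apply, hc, smul_eq_mul, smul_eq_mul,
      ← ENNReal.ofReal_mul (by linarith)]
    have hq' : (Fintype.card A : ℝ) - 1 ≠ 0 := by linarith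
    by_cases h : a = c
    · rw [if_pos h, if_pos (sub_eq_zero.2 h), measure_univ, mul_one,
        ← ENNReal.ofReal_add (by linarith) (by positivity), hε]
      congr 1
      field_simp
      ring
    · rw [if_neg h, if_neg (sub_ne_zero.2 h), measure_empty, mul_zero, zero_add, hε]
      congr 1
      field_simp
  · have : {l : Bool × B | l.1 = false} = {false} ×ˢ Set.univ := by ext; simp
    rw [this, flagValueLaw, Measure.prod_prod, measure_univ, mul_one]
    simp only [Measure.add_apply, Measure.smul_apply, Measure.dirac_apply, smul_eq_mul]
    have h2 : (2 : ENNReal) = ENNReal.ofReal 2 := by simp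
    simp only [Set.mem_singleton_iff, Set.indicator_of_mem, Pi.one_apply, mul_one, Bool.true_eq_false,
      not_false_eq_true, Set.indicator_of_notMem, mul_zero, add_zero]
    rw [h2, ← ENNReal.ofReal_mul (by norm_num), ENNReal.ofReal_lt_one]
    linarith

end Rule

end FactorFiltrations

theorem mainTheorem2 {A : Type*} [AddCommGroup A] [Fintype A] [Nontrivial A]
    [MeasurableSpace A] [DiscreteMeasurableSpace A] :
    ∃ ε₀ : ℝ, 0 < ε₀ ∧ ε₀ < ((Fintype.card A : ℝ) - 1) / Fintype.card A ∧
      ∀ ε : ℝ, ε₀ < ε → ε ≤ ((Fintype.card A : ℝ) - 1) / Fintype.card A →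
        (∃! P : Measure (ℤ → ℤ → A),
          FactorFiltrations.IsStationaryChain ε P (FactorFiltrations.coord A)) ∧
        ∀ P : Measure (ℤ → ℤ → A),
          FactorFiltrations.IsStationaryChain ε P (FactorFiltrations.coord A) →
          FactorFiltrations.IsDynStandard P (FactorFiltrations.shift A)
            (FactorFiltrations.canonicalFiltration P) := by
  have hq : (1 : ℝ) < Fintype.card A := by exact_mod_cast Fintype.one_lt_card
  set r : ℝ := ((Fintype.card A : ℝ) - 1) / Fintype.card A with hr
  have hr0 : 0 < r := div_pos (by linarith) (by linarith)
  -- Beyond r/2 the resampling probability ε/r exceeds 1/2; the upper bound ε ≤ r keeps it a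
  -- probability.
  refine ⟨r / 2, by linarith, by linarith, fun ε h1 h2 => ?_⟩
  have : Nonempty (Fin (Fintype.card A)) := ⟨⟨0, Fintype.card_pos⟩⟩
  -- Values are coded in `Fin` because `IsDynStandard` asks for a space in `Type`.
  have h := FactorFiltrations.isUpdateRule_flagValueLaw (Fintype.equivFin A).symm (p := ε / r)
    (by rw [lt_div_iff₀ hr0]; linarith) ((div_le_one hr0).2 h2)
    (ε := ε) (by rw [← hr, div_mul_cancel₀ _ hr0.ne'])
  have := h.isProbabilityMeasure_errorLaw
  refine ⟨⟨_, h.isStationaryChain, fun P hP => hP.unique h.isStationaryChain⟩, fun P hP => ?_⟩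
  rw [hP.unique h.isStationaryChain]
  exact h.isDynStandard
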